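/- Let $M(n) = SO(n) \ltimes \mathbb{R}^n$ be the Euclidean motion group, with group law $(A,x)(B,y) = (AB, x + Ay)$, equipped with the product of the Haar measure on $SO(n)$ of total mass $1$ and Lebesgue measure on $\mathbb{R}^n$. Let $K \subseteq \mathbb{R}^n$ be a convex body, i.e. a compact convex set with nonempty interior. Let $f \colon M(n) \to \mathbb{R}$ be rapidly decreasing, i.e. $f$ is $C^\infty$ and every derivative of $f$ (with respect to the invariant differential operators in the directions of $\mathfrak{so}(n)$ and of $\mathbb{R}^n$), multiplied by any polynomial in $x$, is bounded on $M(n)$. Suppose that (i) $f(A,x) \le 0$ whenever $(x + AK)^\circ \cap K^\circ = \emptyset$, where ${}^\circ$ denotes the interior; (ii) $\int_{M(n)} f(A,x)\, d(A,x) \ge \operatorname{vol} K$; (iii) $f$ is of positive type, i.e. $f \in L^1(M(n))$, $f(g) = \overline{f(g^{-1})}$ for all $g \in M(n)$, and $$\int_{M(n)} \int_{M(n)} f(h^{-1} g)\, \rho(g)\, \overline{\rho(h)}\, dg\, dh \ge 0$$ for every $\rho \in L^\infty(M(n))$ for which this double integral converges absolutely. A packing of congruent copies of $K$ is a union $P =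 \bigcup_{(A,x) \in S} (x + AK)$, where $S \subseteq M(n)$ is such that $(x + AK)^\circ \cap (y + BK)^\circ = \emptyset$ for all distinct $(A,x), (B,y) \in S$. Its upper density is $$\limsup_{r \to \infty}\, \sup_{p \in \mathbb{R}^n} \frac{\operatorname{vol}(B(p,r) \cap P)}{\operatorname{vol} B(p,r)},$$ where $B(p,r)$ is the ball of radius $r$ centered at $p$, and it has density $\Delta$ if $\lim_{r \to \infty} \operatorname{vol}(B(p,r) \cap P) / \operatorname{vol} B(p,r) = \Delta$ for every $p \in \mathbb{R}^n$. Then every packing of congruent copies of $K$ has upper density at most $f(I,0)$; in particular, if it has a density, then that density is at most $f(I,0)$. -/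

import Mathlib

open MeasureTheory Filter Topology Matrix

/-- Euclidean space `ℝⁿ`. -/
abbrev EucSpace (n : ℕ) : Type := EuclideanSpace ℝ (Fin n)

/-- The rotation group `SO(n)`, with the topology of real `n × n` matrices. -/
abbrev RotGroup (n : ℕ) : Type := Matrix.specialOrthogonalGroup (Fin n) ℝ

namespace RotGroup

variable {n : ℕ}

theorem mul_transpose (A : RotGroup n) : A.1 * A.1ᵀ = 1 :=
  (Matrix.mem_orthogonalGroup_iff _ _).1 A.2.1

theorem coe_inv (A : RotGroup n) : (A⁻¹).1 = A.1ᵀ := rfl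

instance : IsTopologicalGroup (RotGroup n) where
  continuous_mul :=
    Continuous.subtype_mk
      ((continuous_subtype_val.comp continuous_fst).matrix_mul
        (continuous_subtype_val.comp continuous_snd)) _
  continuous_inv := Continuous.subtype_mk continuous_subtype_val.matrix_transpose _

theorem entry_mem_Icc (A : RotGroup n) (i j : Fin n) : A.1 i j ∈ Set.Icc (-1 : ℝ) 1 := by
  have h := congrFun (congrFun (mul_transpose A) i) i
  rw [Matrix.mul_apply, Matrix.one_apply_eq] at h
  have h2 : A.1 i j * A.1ᵀ j i ≤ ∑ k, A.1 i k * A.1ᵀ k i :=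
    Finset.single_le_sum (f := fun k => A.1 i k * A.1ᵀ k i)
      (fun k _ => mul_self_nonneg (A.1 i k)) (Finset.mem_univ j)
  rw [h, Matrix.transpose_apply] at h2
  exact abs_le.1 (abs_le_one_iff_mul_self_le_one.2 h2)

instance : CompactSpace (RotGroup n) := by
  have hB : IsCompact (Set.pi Set.univ fun _ : Fin n =>
      Set.pi Set.univ fun _ : Fin n => Set.Icc (-1 : ℝ) 1) :=
    isCompact_univ_pi fun _ => isCompact_univ_pi fun _ => isCompact_Icc
  have hC : IsClosed {A : Matrix (Fin n) (Fin n) ℝ | A * Aᵀ = 1 ∧ A.det = 1} :=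
    (isClosed_eq (continuous_id.matrix_mul continuous_id.matrix_transpose)
      continuous_const).inter (isClosed_eq continuous_id.matrix_det continuous_const)
  have hS : {A : Matrix (Fin n) (Fin n) ℝ | A * Aᵀ = 1 ∧ A.det = 1} =
      (Matrix.specialOrthogonalGroup (Fin n) ℝ : Set (Matrix (Fin n) (Fin n) ℝ)) := by
    ext A
    exact Iff.symm <| and_congr (Matrix.mem_orthogonalGroup_iff _ _) Iff.rfl
  rw [hS] at hC
  refine isCompact_iff_compactSpace.1 (hB.of_isClosed_subset hC ?_)
  intro A hA i _ j _
  exact entry_mem_Icc ⟨A, hA⟩ i j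

/-- `SO(n)` carries its Borel `σ`-algebra. -/
instance : MeasurableSpace (RotGroup n) := borel _

instance : BorelSpace (RotGroup n) := ⟨rfl⟩

/-- The Haar measure of `SO(n)`, normalized to have total mass `1`. -/
noncomputable def haar (n : ℕ) : Measure (RotGroup n) :=
  Measure.haarMeasure (⊤ : TopologicalSpace.PositiveCompacts (RotGroup n))

/-- The vector `A v`. -/
def rotate (A : RotGroup n) (v : EucSpace n) : EucSpace n :=
  WithLp.toLp 2 (A.1 *ᵥ v.ofLp)

theorem rotate_add (A : RotGroup n) (v w : EucSpace n) :
    A.rotate (v + w) = A.rotate v + A.rotate w := by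
  simp [rotate, Matrix.mulVec_add]

theorem one_rotate (v : EucSpace n) : (1 : RotGroup n).rotate v = v := by
  simp [rotate]

theorem mul_rotate (A B : RotGroup n) (v : EucSpace n) :
    (A * B).rotate v = A.rotate (B.rotate v) := by
  simp [rotate, Matrix.mulVec_mulVec]

theorem rotate_zero (A : RotGroup n) : A.rotate 0 = 0 := by
  simp [rotate]

end RotGroup

/-- The Euclidean motion group `M(n) = SO(n) ⋉ ℝⁿ`. As a topological and measurable space it is
the product `SO(n) × ℝⁿ`. -/
abbrev MotionGroup (n : ℕ) : Type := RotGroup n × EucSpace n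

namespace MotionGroup

variable {n : ℕ}

/-- The group law `(A, x) (B, y) = (A B, x + A y)`, with identity `(I, 0)` and inverse
`(A, x)⁻¹ = (A⁻¹, -A⁻¹ x)`. -/
instance : Group (MotionGroup n) where
  mul g h := (g.1 * h.1, g.2 + g.1.rotate h.2)
  one := (1, 0)
  inv g := (g.1⁻¹, -(g.1⁻¹).rotate g.2)
  mul_assoc g h k := by
    refine Prod.ext (mul_assoc g.1 h.1 k.1) ?_
    change (g.2 + g.1.rotate h.2) + (g.1 * h.1).rotate k.2 =
      g.2 + g.1.rotate (h.2 + h.1.rotate k.2)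
    rw [RotGroup.rotate_add, RotGroup.mul_rotate, add_assoc]
  one_mul g := by
    refine Prod.ext (one_mul g.1) ?_
    change 0 + (1 : RotGroup n).rotate g.2 = g.2
    rw [RotGroup.one_rotate, zero_add]
  mul_one g := by
    refine Prod.ext (mul_one g.1) ?_
    change g.2 + g.1.rotate 0 = g.2
    rw [RotGroup.rotate_zero, add_zero]
  inv_mul_cancel g := by
    refine Prod.ext (inv_mul_cancel g.1) ?_
    change -(g.1⁻¹).rotate g.2 + (g.1⁻¹).rotate g.2 = 0
    exact neg_add_cancel _

theorem mul_def (g h : MotionGroup n) : g * h = (g.1 * h.1, g.2 + g.1.rotate h.2) := rfl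

theorem one_def : (1 : MotionGroup n) = (1, 0) := rfl

theorem inv_def (g : MotionGroup n) : g⁻¹ = (g.1⁻¹, -(g.1⁻¹).rotate g.2) := rfl

/-- The product of the normalized Haar measure of `SO(n)` and Lebesgue measure of `ℝⁿ`. -/
noncomputable def haar (n : ℕ) : Measure (MotionGroup n) :=
  (RotGroup.haar n).prod volume

/-- The congruent copy `x + A K` of `K`, where `g = (A, x)`. -/
def copy (g : MotionGroup n) (K : Set (EucSpace n)) : Set (EucSpace n) :=
  (fun v => g.2 + g.1.rotate v) '' K

end MotionGroup

/-- The Lie algebra `so(n)` of skew-symmetric real `n × n` matrices. -/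
def SkewMatrix (n : ℕ) : Submodule ℝ (Matrix (Fin n) (Fin n) ℝ) where
  carrier := {X | Xᵀ = -X}
  add_mem' {X Y} hX hY := by
    change (X + Y)ᵀ = -(X + Y)
    rw [Matrix.transpose_add, hX, hY, neg_add]
  zero_mem' := by
    change (0 : Matrix (Fin n) (Fin n) ℝ)ᵀ = -0
    rw [Matrix.transpose_zero, neg_zero]
  smul_mem' c X hX := by
    change (c • X)ᵀ = -(c • X)
    rw [Matrix.transpose_smul, hX, smul_neg]

theorem SkewMatrix.exp_mem {n : ℕ} (X : SkewMatrix n) :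
    NormedSpace.exp X.1 ∈ Matrix.specialOrthogonalGroup (Fin n) ℝ := by
  have orth : ∀ Y : Matrix (Fin n) (Fin n) ℝ, Yᵀ = -Y →
      NormedSpace.exp Y * (NormedSpace.exp Y)ᵀ = 1 := by
    intro Y hY
    rw [← Matrix.exp_transpose, hY,
      ← Matrix.exp_add_of_commute Y (-Y) (Commute.neg_right (Commute.refl Y)), add_neg_cancel, NormedSpace.exp_zero]
  have hX : X.1ᵀ = -X.1 := X.2
  refine Matrix.mem_specialOrthogonalGroup_iff.2
    ⟨(Matrix.mem_orthogonalGroup_iff _ _).2 (orth X.1 hX), ?_⟩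
  have hY : ((2 : ℝ)⁻¹ • X.1)ᵀ = -((2 : ℝ)⁻¹ • X.1) := by
    rw [Matrix.transpose_smul, hX, smul_neg]
  have hsum : X.1 = (2 : ℝ)⁻¹ • X.1 + (2 : ℝ)⁻¹ • X.1 := by
    rw [← add_smul]; norm_num
  have hdet := congrArg Matrix.det (orth _ hY)
  rw [Matrix.det_mul, Matrix.det_transpose, Matrix.det_one] at hdet
  rw [hsum, Matrix.exp_add_of_commute _ _ (Commute.refl _), Matrix.det_mul, hdet]

/-- The exponential map `so(n) → SO(n)`. -/
noncomputable def SkewMatrix.exp {n : ℕ} (X : SkewMatrix n) : RotGroup n :=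
  ⟨NormedSpace.exp X.1, SkewMatrix.exp_mem X⟩

section RapidlyDecreasing

-- a norm on matrices, which makes `so(n) × ℝⁿ` a normed space; the choice is immaterial
attribute [local instance] Matrix.linftyOpNormedAddCommGroup Matrix.linftyOpNormedSpace

/-- The function `f` in exponential coordinates around the rotation `A`:
`(X, x) ↦ f (A exp X, x)`. -/
noncomputable def inExpCoords {n : ℕ} (f : MotionGroup n → ℝ) (A : RotGroup n) :
    SkewMatrix n × EucSpace n → ℝ :=
  fun p => f (A * SkewMatrix.exp p.1, p.2)

/-- Rapidly decreasing functions on the motion group: `f` is smooth and every derivative of it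
(in the directions of `so(n)` and of `ℝⁿ`), multiplied by any polynomial in `x`, is bounded on
`SO(n) × ℝⁿ`. The exponential coordinates around the points `A` form a smooth atlas of `SO(n)`
when restricted to neighbourhoods of `0`, and the partial derivatives at `X = 0` of
`(X, x) ↦ f (A exp X, x)` are the symmetrized derivatives of `f` by left-invariant vector fields
of `SO(n)` and coordinate vector fields of `ℝⁿ`, which span all the invariant ones. -/
def RapidlyDecreasing {n : ℕ} (f : MotionGroup n → ℝ) : Prop :=
  Continuous f ∧
  (∀ A : RotGroup n, ContDiff ℝ (⊤ : ℕ∞) (inExpCoords f A)) ∧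
  ∀ k m : ℕ, ∃ C : ℝ, ∀ (A : RotGroup n) (x : EucSpace n),
    ‖x‖ ^ m * ‖iteratedFDeriv ℝ k (inExpCoords f A) (0, x)‖ ≤ C

end RapidlyDecreasing

section PositiveType

open scoped ComplexOrder

/-- Functions of positive type on the motion group: `f ∈ L¹`, `f (g) = conj (f (g⁻¹))`, and
`∫ ∫ f (h⁻¹ g) ρ (g) conj (ρ (h)) dg dh ≥ 0` for every `ρ ∈ L^∞` for which this double integral
exists (over the noncompact group it need not converge, e.g. for a constant `ρ`). -/
def IsPositiveType {n : ℕ} (f : MotionGroup n → ℂ) : Prop :=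
  Integrable f (MotionGroup.haar n) ∧
  (∀ g, f g = starRingEnd ℂ (f g⁻¹)) ∧
  ∀ ρ : MotionGroup n → ℂ, MemLp ρ ⊤ (MotionGroup.haar n) →
    Integrable (fun p : MotionGroup n × MotionGroup n =>
      f (p.2⁻¹ * p.1) * ρ p.1 * starRingEnd ℂ (ρ p.2))
      ((MotionGroup.haar n).prod (MotionGroup.haar n)) →
    0 ≤ ∫ h, ∫ g, f (h⁻¹ * g) * ρ g * starRingEnd ℂ (ρ h)
      ∂(MotionGroup.haar n) ∂(MotionGroup.haar n)

end PositiveType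

section Packing

variable {n : ℕ}

/-- `S` is an independent set of the congruent packing graph of `K`: the interiors of the copies
`x + A K`, `(A, x) ∈ S`, are pairwise disjoint. -/
def IsCongruentPacking (K : Set (EucSpace n)) (S : Set (MotionGroup n)) : Prop :=
  ∀ g ∈ S, ∀ h ∈ S, g ≠ h → interior (g.copy K) ∩ interior (h.copy K) = ∅

/-- The union of the copies `x + A K`, `(A, x) ∈ S`. -/
def packingUnion (K : Set (EucSpace n)) (S : Set (MotionGroup n)) : Set (EucSpace n) :=
  ⋃ g ∈ S, g.copy K

/-- The fraction `vol (B(p, r) ∩ P) / vol B(p, r)` of the ball `B(p, r)` covered by `P`. -/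
noncomputable def coveredFraction (P : Set (EucSpace n)) (p : EucSpace n) (r : ℝ) : ℝ :=
  volume.real (Metric.ball p r ∩ P) / volume.real (Metric.ball p r)

/-- `P` has density `Δ`. -/
def HasDensity (P : Set (EucSpace n)) (Δ : ℝ) : Prop :=
  ∀ p : EucSpace n, Tendsto (fun r : ℝ => coveredFraction P p r) atTop (𝓝 Δ)

/-- The upper density `limsup_{r → ∞} sup_p vol (B(p, r) ∩ P) / vol B(p, r)`. The quantities
under the limit lie in `[0, 1]`. -/
noncomputable def upperDensity (P : Set (EucSpace n)) : ℝ :=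
  limsup (fun r : ℝ => ⨆ p : EucSpace n, coveredFraction P p r) atTop

end Packing

/-! ### Rotations: isometric action on `ℝⁿ` and Haar probability measure. -/

namespace RotGroup

variable {n : ℕ}

/-! A Delsarte-type bound proved directly, without Fourier analysis. For the finite set `T` of
motions of the packing with translation part in a ball of radius `s` and volume `V`, test positive
type against the point masses at `T` minus `l` times Haar measure on a slightly larger cylinder.
Write `F = ∫ f`.

The point-mass sum is at most `|T| f(1)`, because `f ≤ 0` at `h⁻¹ * g` for distinct `g`, `h` in `T`.
As `f` is integrable, the mixed integrals are nearly `|T| F` and the square of the Haar part is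
nearly `V F`, up to a boundary shell of relative volume tending to `0` (`quadratic_bound`). With `l
= |T| / V` the inequality becomes `|T| F ≤ V f(1)` in the limit (`eventually_card_mul_le`). Since `F
≥ vol K`, the covered fraction `|T| vol K / V` is asymptotically at most `f(1)`, uniformly in the
centre.

Point masses are not `L^∞` functions; `kernel_nonneg_pointMasses` reaches them from normalized
indicators of small compact neighbourhoods, using continuity of `f`. -/

theorem transpose_mul (A : RotGroup n) : A.1ᵀ * A.1 = 1 :=
  (Matrix.mem_orthogonalGroup_iff' _ _).1 A.2.1

theorem norm_rotate (A : RotGroup n) (v : EucSpace n) : ‖A.rotate v‖ = ‖v‖ := by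
  rw [← sq_eq_sq₀ (norm_nonneg _) (norm_nonneg _), ← real_inner_self_eq_norm_sq,
    ← real_inner_self_eq_norm_sq, EuclideanSpace.inner_eq_star_dotProduct,
    EuclideanSpace.inner_eq_star_dotProduct]
  simp only [rotate, star_trivial]
  rw [Matrix.dotProduct_mulVec, Matrix.vecMul_mulVec, ← Matrix.dotProduct_mulVec]
  rw [transpose_mul, Matrix.one_mulVec]

/-- A rotation as a linear isometry of `ℝⁿ`. -/
def isometryEquiv (A : RotGroup n) : EucSpace n ≃ₗᵢ[ℝ] EucSpace n where
  toFun := A.rotate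
  invFun := (A⁻¹).rotate
  map_add' := A.rotate_add
  map_smul' c v := by simp [rotate, Matrix.mulVec_smul]
  left_inv v := by rw [← mul_rotate, inv_mul_cancel, one_rotate]
  right_inv v := by rw [← mul_rotate, mul_inv_cancel, one_rotate]
  norm_map' := A.norm_rotate

theorem continuous_rotate :
    Continuous fun p : RotGroup n × EucSpace n => p.1.rotate p.2 := by
  refine (PiLp.continuous_toLp 2 _).comp ?_
  exact (continuous_subtype_val.comp continuous_fst).matrix_mulVec
    ((PiLp.continuous_ofLp 2 _).comp continuous_snd)

instance : SecondCountableTopology (RotGroup n) :=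
  haveI : SecondCountableTopology (Matrix (Fin n) (Fin n) ℝ) :=
    inferInstanceAs (SecondCountableTopology (Fin n → Fin n → ℝ))
  TopologicalSpace.Subtype.secondCountableTopology _

instance : (haar n).IsHaarMeasure := by unfold haar; infer_instance

instance : IsProbabilityMeasure (haar n) :=
  ⟨Measure.haarMeasure_self⟩

end RotGroup

/-! ### The motion group: topology, left-invariant measure, action on bodies. -/

namespace MotionGroup

variable {n : ℕ}

instance : IsTopologicalGroup (MotionGroup n) where
  continuous_mul := by
    refine Continuous.prodMk (by fun_prop) ?_
    refine Continuous.add (by fun_prop) ?_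
    exact RotGroup.continuous_rotate.comp
      (f := fun p : MotionGroup n × MotionGroup n => (p.1.1, p.2.2)) (by fun_prop)
  continuous_inv := by
    refine Continuous.prodMk (by fun_prop) (Continuous.neg ?_)
    exact RotGroup.continuous_rotate.comp
      (f := fun p : MotionGroup n => (p.1⁻¹, p.2)) (by fun_prop)

instance : SFinite (haar n) := by unfold haar; infer_instance

instance : (haar n).IsOpenPosMeasure := by unfold haar; infer_instance

instance : IsFiniteMeasureOnCompacts (haar n) := by unfold haar; infer_instance

/-- Left translation by a fixed `g` splits as a product map, a left translation of `SO(n)` times a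
rigid motion of `ℝⁿ`, and each factor preserves its measure. -/
instance : (haar n).IsMulLeftInvariant where
  map_mul_left_eq_self g := by
    have h1 : MeasurePreserving (fun B : RotGroup n => g.1 * B)
        (RotGroup.haar n) (RotGroup.haar n) := measurePreserving_mul_left _ _
    have h2 : MeasurePreserving (fun y : EucSpace n => g.2 + g.1.rotate y) volume volume :=
      (measurePreserving_add_left volume g.2).comp g.1.isometryEquiv.measurePreserving
    exact (h1.prod h2).map_eq

theorem haar_real_univ_prod (s : Set (EucSpace n)) :
    (haar n).real (Set.univ ×ˢ s) = volume.real s := by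
  simp [haar, measureReal_prod_prod]

/-- The motion `v ↦ x + A v` of `ℝⁿ`, where `g = (A, x)`. -/
noncomputable def isometryEquiv (g : MotionGroup n) : EucSpace n ≃ᵢ EucSpace n :=
  g.1.isometryEquiv.toIsometryEquiv.trans (IsometryEquiv.addLeft g.2)

theorem isometryEquiv_image (g : MotionGroup n) (K : Set (EucSpace n)) :
    g.isometryEquiv '' K = g.copy K := rfl

theorem copy_mul (g h : MotionGroup n) (K : Set (EucSpace n)) :
    (g * h).copy K = g.copy (h.copy K) := by
  simp only [copy, Set.image_image, mul_def, RotGroup.rotate_add, RotGroup.mul_rotate, add_assoc]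

theorem copy_one (K : Set (EucSpace n)) : (1 : MotionGroup n).copy K = K := by
  simp [copy, one_def, RotGroup.one_rotate]

theorem interior_copy (g : MotionGroup n) (K : Set (EucSpace n)) :
    interior (g.copy K) = g.copy (interior K) :=
  (g.isometryEquiv.toHomeomorph.image_interior K).symm

theorem volume_copy (g : MotionGroup n) (K : Set (EucSpace n)) :
    volume (g.copy K) = volume K := by
  have h : g.copy K = (fun v => g.2 + v) '' (g.1.isometryEquiv '' K) := by
    rw [Set.image_image]; rfl
  rw [h, Set.image_add_left, measure_preimage_add]
  rw [LinearIsometryEquiv.image_eq_preimage_symm]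
  exact (g.1.isometryEquiv.symm.measurePreserving).measure_preimage_equiv
    (f := g.1.isometryEquiv.symm.toMeasurableEquiv) K

/-- Applying the motion `h⁻¹` to both copies turns disjointness within a packing into the condition
under which `f` is assumed nonpositive. -/
theorem interior_inv_mul_copy_inter {g h : MotionGroup n} {K : Set (EucSpace n)}
    (hgh : interior (g.copy K) ∩ interior (h.copy K) = ∅) :
    interior ((h⁻¹ * g).copy K) ∩ interior K = ∅ := by
  have hK : K = h⁻¹.copy (h.copy K) := by rw [← copy_mul, inv_mul_cancel, copy_one]
  have h1 : interior ((h⁻¹ * g).copy K) = h⁻¹.copy (interior (g.copy K)) := by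
    rw [copy_mul, interior_copy]
  have h2 : interior K = h⁻¹.copy (interior (h.copy K)) := by
    conv_lhs => rw [hK, interior_copy]
  rw [h1, h2, ← isometryEquiv_image, ← isometryEquiv_image _ (interior (h.copy K)),
    ← Set.image_inter (isometryEquiv _).injective, hgh, Set.image_empty]

end MotionGroup

/-! ### From positivity on indicators to positivity on point masses. -/

section Kernel

variable {X : Type*} [TopologicalSpace X]

/-- Finiteness of `T` allows one neighbourhood of each point to serve every pair, in either
coordinate. Upper estimates suffice, since the goal is to bound a nonnegative quadratic form from
above. -/
theorem exists_compact_nhds_kernel_approx [LocallyCompactSpace X] [T2Space X] {k : X × X → ℝ}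
    (hk : Continuous k) {φ : X → ℝ} (hφ : Continuous φ) (T : Finset X) {ε : ℝ} (hε : 0 < ε) :
    ∃ E : X → Set X, (∀ g ∈ T, IsCompact (E g) ∧ E g ∈ 𝓝 g) ∧
      (∀ g ∈ T, ∀ h ∈ T, ∀ x ∈ E g, ∀ y ∈ E h, k (x, y) ≤ k (g, h) + ε) ∧
      ∀ g ∈ T, ∀ x ∈ E g, φ x ≤ φ g + ε := by
  have h1 : ∀ g h : X, ∃ U ∈ 𝓝 g, ∃ W ∈ 𝓝 h, ∀ x ∈ U, ∀ y ∈ W, k (x, y) ≤ k (g, h) + ε := by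
    intro g h
    have := hk.continuousAt (x := (g, h)) (Iio_mem_nhds (lt_add_of_pos_right (k (g, h)) hε))
    rw [Filter.mem_map, nhds_prod_eq, Filter.mem_prod_iff] at this
    obtain ⟨U, hU, W, hW, hUW⟩ := this
    exact ⟨U, hU, W, hW, fun x hx y hy => le_of_lt (hUW (Set.mk_mem_prod hx hy))⟩
  choose U hU W hW hUW using h1
  have h2 : ∀ g : X, {x | φ x ≤ φ g + ε} ∈ 𝓝 g := fun g =>
    Filter.mem_of_superset
      (hφ.continuousAt (Iio_mem_nhds (lt_add_of_pos_right (φ g) hε))) fun x (hx : φ x < φ g + ε) => hx.le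
  have h3 : ∀ g : X, ∃ E, IsCompact E ∧ E ∈ 𝓝 g ∧
      E ⊆ ((⋂ h ∈ T, U g h) ∩ ⋂ h ∈ T, W h g) ∩ {x | φ x ≤ φ g + ε} := by
    intro g
    have hm : ((⋂ h ∈ T, U g h) ∩ ⋂ h ∈ T, W h g) ∩ {x | φ x ≤ φ g + ε} ∈ 𝓝 g :=
      inter_mem (inter_mem ((biInter_finset_mem T).2 fun h _ => hU g h)
        ((biInter_finset_mem T).2 fun h _ => hW h g)) (h2 g)
    obtain ⟨E, hE, hsub, hc⟩ := local_compact_nhds hm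
    exact ⟨E, hc, hE, hsub⟩
  choose E hEc hEn hEs using h3
  refine ⟨E, fun g _ => ⟨hEc g, hEn g⟩, fun g hg h hh x hx y hy => ?_, fun g _ x hx => (hEs g hx).2⟩
  exact hUW g h x (Set.mem_iInter₂.1 (hEs g hx).1.1 h hh) y (Set.mem_iInter₂.1 (hEs h hy).1.2 g hg)

variable [MeasurableSpace X] [OpensMeasurableSpace X] [SecondCountableTopology X] [LocallyCompactSpace X] [T2Space X]

/-- A continuous symmetric kernel which is positive definite when tested against linear
combinations of indicators of compact sets is positive definite when tested against
combinations of point masses and the indicator of a compact set. -/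
theorem kernel_nonneg_pointMasses (μ : Measure X) [SFinite μ]
    [μ.IsOpenPosMeasure] [IsFiniteMeasureOnCompacts μ] {k : X × X → ℝ} (hk : Continuous k)
    (hsymm : ∀ x y, k (x, y) = k (y, x))
    (hpos : ∀ (I : Finset (Option X)) (E : Option X → Set X) (c : Option X → ℝ),
      (∀ i ∈ I, IsCompact (E i)) →
      0 ≤ ∑ i ∈ I, ∑ j ∈ I, c i * c j * ∫ p in E i ×ˢ E j, k p ∂(μ.prod μ))
    (T : Finset X) {B : Set X} (hB : IsCompact B) (l : ℝ) :
    0 ≤ ∑ g ∈ T, ∑ h ∈ T, k (g, h) - 2 * l * ∑ g ∈ T, ∫ y in B, k (g, y) ∂μ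
      + l ^ 2 * ∫ p in B ×ˢ B, k p ∂(μ.prod μ) := by
  have hφ : Continuous fun x => -l * ∫ y in B, k (x, y) ∂μ :=
    continuous_const.mul (continuous_parametric_integral_of_continuous
      (f := fun x y => k (x, y)) hk hB)
  have hint : ∀ {C D : Set X}, IsCompact C → IsCompact D → IntegrableOn k (C ×ˢ D) (μ.prod μ) :=
    fun hC hD => hk.continuousOn.integrableOn_compact (hC.prod hD)
  have key : ∀ ε : ℝ, 0 < ε →
      0 ≤ (∑ g ∈ T, ∑ h ∈ T, k (g, h) - 2 * l * ∑ g ∈ T, ∫ y in B, k (g, y) ∂μ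
      + l ^ 2 * ∫ p in B ×ˢ B, k p ∂(μ.prod μ)) + (T.card * T.card + 2 * T.card) * ε := by
    intro ε hε
    obtain ⟨E, hE, hEk, hEφ⟩ := exists_compact_nhds_kernel_approx hk hφ T hε
    have hm : ∀ g ∈ T, 0 < μ.real (E g) := fun g hg =>
      ENNReal.toReal_pos (Measure.measure_pos_of_mem_nhds μ (hE g hg).2).ne' (hE g hg).1.measure_ne_top
    -- The index `none` carries `-l` times the indicator of `B`; each `some g` carries the indicator
    -- of `E g` normalized to integral `1`, standing in for the point mass at `g`. The sets may
    -- overlap.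
    have h := hpos T.insertNone (fun i => i.elim B E)
      (fun i => i.elim (-l) fun g => (μ.real (E g))⁻¹) (by
        intro i hi
        cases i with
        | none => exact hB
        | some g => exact (hE g (Finset.some_mem_insertNone.1 hi)).1)
    simp only [Finset.sum_insertNone, Option.elim_none, Option.elim_some] at h
    have hpair : ∀ g ∈ T, ∀ h ∈ T, (μ.real (E g))⁻¹ * (μ.real (E h))⁻¹ *
        ∫ p in E g ×ˢ E h, k p ∂(μ.prod μ) ≤ k (g, h) + ε := by
      intro g hg h hh
      have h0 : ∫ p in E g ×ˢ E h, k p ∂(μ.prod μ) ≤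
          ∫ p in E g ×ˢ E h, (k (g, h) + ε) ∂(μ.prod μ) :=
        setIntegral_mono_on (hint (hE g hg).1 (hE h hh).1)
          (continuousOn_const.integrableOn_compact ((hE g hg).1.prod (hE h hh).1))
          ((hE g hg).1.measurableSet.prod (hE h hh).1.measurableSet)
          fun p hp => hEk g hg h hh p.1 hp.1 p.2 hp.2
      rw [setIntegral_const, measureReal_prod_prod, smul_eq_mul] at h0
      have h1 := hm g hg
      have h2 := hm h hh
      rw [← mul_inv, inv_mul_le_iff₀ (mul_pos h1 h2)]
      exact h0
    have hcross : ∀ g ∈ T, (μ.real (E g))⁻¹ * -l *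
        ∫ p in E g ×ˢ B, k p ∂(μ.prod μ) ≤ -l * (∫ y in B, k (g, y) ∂μ) + ε := by
      intro g hg
      rw [setIntegral_prod _ (hint (hE g hg).1 hB), mul_assoc, inv_mul_le_iff₀ (hm g hg),
        ← integral_const_mul]
      have h0 : ∫ x in E g, -l * (∫ y in B, k (x, y) ∂μ) ∂μ ≤
          ∫ x in E g, (-l * (∫ y in B, k (g, y) ∂μ) + ε) ∂μ :=
        setIntegral_mono_on (hφ.continuousOn.integrableOn_compact (hE g hg).1)
          (continuousOn_const.integrableOn_compact (hE g hg).1)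
          (hE g hg).1.measurableSet fun x hx => hEφ g hg x hx
      rwa [setIntegral_const, smul_eq_mul] at h0
    -- Symmetry of `k` identifies the two families of mixed terms, whence the factor `2 * l`.
    have hswap : ∀ g, ∫ p in B ×ˢ E g, k p ∂(μ.prod μ) = ∫ p in E g ×ˢ B, k p ∂(μ.prod μ) := by
      intro g
      rw [← setIntegral_prod_swap]
      exact integral_congr_ae (Eventually.of_forall fun p => hsymm _ _)
    have hs1 : ∑ g ∈ T, ∑ h ∈ T, (μ.real (E g))⁻¹ * (μ.real (E h))⁻¹ *
        ∫ p in E g ×ˢ E h, k p ∂(μ.prod μ) ≤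
        ∑ g ∈ T, ∑ h ∈ T, k (g, h) + T.card * T.card * ε := by
      refine (Finset.sum_le_sum fun g hg => Finset.sum_le_sum fun h hh =>
        hpair g hg h hh).trans_eq ?_
      simp only [Finset.sum_add_distrib, Finset.sum_const, nsmul_eq_mul]
      ring
    have hs2 : ∑ g ∈ T, (μ.real (E g))⁻¹ * -l * ∫ p in E g ×ˢ B, k p ∂(μ.prod μ) ≤
        -l * ∑ g ∈ T, ∫ y in B, k (g, y) ∂μ + T.card * ε := by
      refine (Finset.sum_le_sum hcross).trans_eq ?_
      simp only [Finset.sum_add_distrib, Finset.sum_const, nsmul_eq_mul, Finset.mul_sum]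
    simp only [hswap, Finset.sum_add_distrib] at h
    have hs3 : ∑ g ∈ T, -l * (μ.real (E g))⁻¹ * ∫ p in E g ×ˢ B, k p ∂(μ.prod μ) =
        ∑ g ∈ T, (μ.real (E g))⁻¹ * -l * ∫ p in E g ×ˢ B, k p ∂(μ.prod μ) :=
      Finset.sum_congr rfl fun g _ => by ring
    rw [hs3] at h
    linarith
  refine le_of_forall_pos_le_add fun δ hδ => ?_
  -- The summand `1` keeps the divisor positive when `T` is empty.
  have hM : (0 : ℝ) < T.card * T.card + 2 * T.card + 1 := by positivity
  have := key (δ / (T.card * T.card + 2 * T.card + 1)) (div_pos hδ hM)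
  refine this.trans (add_le_add_right ?_ _)
  rw [mul_div_left_comm]
  refine mul_le_of_le_one_right hδ.le ((div_le_one hM).2 (by linarith))

end Kernel

/-! ### The positive type inequality and estimates on cylinders. -/

namespace MotionGroup

variable {n : ℕ} {f : MotionGroup n → ℝ}

theorem continuous_kernel (hc : Continuous f) :
    Continuous fun p : MotionGroup n × MotionGroup n => f (p.2⁻¹ * p.1) :=
  hc.comp (continuous_snd.inv.mul continuous_fst)

theorem sum_setIntegral_nonneg_of_isPositiveType (hc : Continuous f)
    (hp : IsPositiveType fun g => (f g : ℂ)) {ι : Type*} (I : Finset ι)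
    (E : ι → Set (MotionGroup n)) (c : ι → ℝ) (hE : ∀ i ∈ I, IsCompact (E i)) :
    0 ≤ ∑ i ∈ I, ∑ j ∈ I, c i * c j *
      ∫ p in E i ×ˢ E j, f (p.2⁻¹ * p.1) ∂((haar n).prod (haar n)) := by
  set ρ : MotionGroup n → ℝ := fun g => ∑ i ∈ I, (E i).indicator (fun _ => c i) g with hρ
  have hmeas : ∀ i ∈ I, MeasurableSet (E i) := fun i hi => (hE i hi).measurableSet
  have hexp : ∀ p : MotionGroup n × MotionGroup n, f (p.2⁻¹ * p.1) * ρ p.1 * ρ p.2 =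
      ∑ i ∈ I, ∑ j ∈ I,
        (E i ×ˢ E j).indicator (fun q => c i * c j * f (q.2⁻¹ * q.1)) p := by
    intro p
    rw [hρ, mul_assoc, Finset.sum_mul_sum, Finset.mul_sum]
    refine Finset.sum_congr rfl fun i _ => ?_
    rw [Finset.mul_sum]
    refine Finset.sum_congr rfl fun j _ => ?_
    by_cases h1 : p.1 ∈ E i <;> by_cases h2 : p.2 ∈ E j <;>
      simp [Set.indicator, Set.mem_prod, h1, h2, mul_comm]
  have hterm : ∀ i ∈ I, ∀ j ∈ I, Integrable
      ((E i ×ˢ E j).indicator fun q => c i * c j * f (q.2⁻¹ * q.1))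
      ((haar n).prod (haar n)) := by
    intro i hi j hj
    refine IntegrableOn.integrable_indicator ?_ ((hmeas i hi).prod (hmeas j hj))
    exact ((continuous_const.mul (continuous_kernel hc)).continuousOn).integrableOn_compact
      ((hE i hi).prod (hE j hj))
  have hint : Integrable (fun p : MotionGroup n × MotionGroup n =>
      f (p.2⁻¹ * p.1) * ρ p.1 * ρ p.2) ((haar n).prod (haar n)) := by
    simp only [hexp]
    exact integrable_finsetSum _ fun i hi => integrable_finsetSum _ fun j hj => hterm i hi j hj
  have hval : ∫ p, f (p.2⁻¹ * p.1) * ρ p.1 * ρ p.2 ∂((haar n).prod (haar n)) =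
      ∑ i ∈ I, ∑ j ∈ I, c i * c j *
        ∫ p in E i ×ˢ E j, f (p.2⁻¹ * p.1) ∂((haar n).prod (haar n)) := by
    simp only [hexp]
    rw [integral_finsetSum _ fun i hi => integrable_finsetSum _ fun j hj => hterm i hi j hj]
    refine Finset.sum_congr rfl fun i hi => ?_
    rw [integral_finsetSum _ fun j hj => hterm i hi j hj]
    refine Finset.sum_congr rfl fun j hj => ?_
    rw [integral_indicator ((hmeas i hi).prod (hmeas j hj)), integral_const_mul]
  have hρm : Measurable ρ :=
    Finset.measurable_fun_sum _ fun i hi => measurable_const.indicator (hmeas i hi)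
  have hρb : ∀ g, ‖(ρ g : ℂ)‖ ≤ ∑ i ∈ I, |c i| := by
    intro g
    rw [Complex.norm_real]
    refine (norm_sum_le _ _).trans (Finset.sum_le_sum fun i _ => ?_)
    exact norm_indicator_le_norm_self (fun _ => c i) g
  have h := hp.2.2 (fun g => (ρ g : ℂ))
    (memLp_top_of_bound (Complex.measurable_ofReal.comp hρm).aestronglyMeasurable _
      (Eventually.of_forall hρb))
    (by
      simp only [Complex.conj_ofReal, ← Complex.ofReal_mul]
      exact hint.ofReal)
  simp only [Complex.conj_ofReal, ← Complex.ofReal_mul, integral_complex_ofReal] at h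
  rw [Complex.zero_le_real] at h
  -- Positive type integrates first over `g`, which is the first coordinate of the pair, so the
  -- symmetric form of Fubini is needed.
  rw [← hval, integral_prod_symm _ hint]
  exact h

theorem symm_of_isPositiveType (hp : IsPositiveType fun g => (f g : ℂ)) (g : MotionGroup n) :
    f g⁻¹ = f g := by
  have := hp.2.1 g
  rw [Complex.conj_ofReal, Complex.ofReal_inj] at this
  exact this.symm

theorem integrable_of_isPositiveType (hp : IsPositiveType fun g => (f g : ℂ)) :
    Integrable f (haar n) := hp.1.re

/-- The positive type inequality for the sum of the point masses at `T` minus `l` times the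
Haar measure of a compact set `B`. -/
theorem pointMasses_nonneg (hc : Continuous f) (hp : IsPositiveType fun g => (f g : ℂ))
    (T : Finset (MotionGroup n)) {B : Set (MotionGroup n)} (hB : IsCompact B) (l : ℝ) :
    0 ≤ ∑ g ∈ T, ∑ h ∈ T, f (h⁻¹ * g) - 2 * l * ∑ g ∈ T, ∫ y in B, f (y⁻¹ * g) ∂(haar n)
      + l ^ 2 * ∫ p in B ×ˢ B, f (p.2⁻¹ * p.1) ∂((haar n).prod (haar n)) :=
  kernel_nonneg_pointMasses (haar n) (k := fun p => f (p.2⁻¹ * p.1)) (continuous_kernel hc)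
    (fun x y => by
      rw [← symm_of_isPositiveType hp, _root_.mul_inv_rev, inv_inv])
    (fun I E c hE => sum_setIntegral_nonneg_of_isPositiveType hc hp I E c hE) T hB l

theorem nonneg_one_of_isPositiveType (hc : Continuous f)
    (hp : IsPositiveType fun g => (f g : ℂ)) : 0 ≤ f 1 := by
  have := pointMasses_nonneg hc hp {1} isCompact_empty 0
  simpa using this

/-- Symmetry rewrites the integrand as `f (g⁻¹ * y)`, so left invariance alone suffices for the
substitution `y ↦ g * y`. -/
theorem setIntegral_inv_mul (hs : ∀ g, f g⁻¹ = f g)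
    {B : Set (MotionGroup n)} (hB : MeasurableSet B) (g : MotionGroup n) :
    ∫ y in B, f (y⁻¹ * g) ∂(haar n) = ∫ y in (g * ·) ⁻¹' B, f y ∂(haar n) := by
  have h1 : ∀ y, f (y⁻¹ * g) = f (g⁻¹ * y) := fun y => by
    rw [← hs (y⁻¹ * g), _root_.mul_inv_rev, inv_inv]
  simp only [h1]
  rw [← integral_indicator hB, ← integral_indicator (measurable_const_mul g hB),
    ← integral_mul_left_eq_self _ g]
  refine integral_congr_ae (Eventually.of_forall fun y => ?_)
  by_cases hy : g * y ∈ B <;> simp [Set.indicator, hy]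

theorem setIntegral_le_integral_abs (hf : Integrable f (haar n)) (B : Set (MotionGroup n)) :
    ∫ y in B, f y ∂(haar n) ≤ ∫ y, |f y| ∂(haar n) :=
  (integral_mono hf.integrableOn hf.integrableOn.abs fun _ => le_abs_self _).trans
    (setIntegral_le_integral hf.abs (Eventually.of_forall fun _ => abs_nonneg _))

theorem snd_mul_mem_closedBall {g h : MotionGroup n} {p : EucSpace n} {s R : ℝ}
    (hg : g.2 ∈ Metric.closedBall p s) (hh : ‖h.2‖ ≤ R) :
    (g * h).2 ∈ Metric.closedBall p (s + R) := by
  rw [Metric.mem_closedBall, dist_eq_norm] at *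
  have : (g * h).2 - p = (g.2 - p) + g.1.rotate h.2 := by
    rw [mul_def]; dsimp only; abel
  rw [this]
  exact (norm_add_le _ _).trans (add_le_add hg (by rwa [RotGroup.norm_rotate]))

/-- The motions whose translation part lies in the closed ball `B(p, r)`. -/
def cylinder (p : EucSpace n) (r : ℝ) : Set (MotionGroup n) :=
  Set.univ ×ˢ Metric.closedBall p r

theorem isCompact_cylinder (p : EucSpace n) (r : ℝ) : IsCompact (cylinder p r) :=
  isCompact_univ.prod (isCompact_closedBall p r)

theorem mem_cylinder {p : EucSpace n} {r : ℝ} {g : MotionGroup n} :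
    g ∈ cylinder p r ↔ g.2 ∈ Metric.closedBall p r := by simp [cylinder]

theorem haar_real_cylinder (p : EucSpace n) (r : ℝ) :
    (haar n).real (cylinder p r) = volume.real (Metric.closedBall (0 : EucSpace n) r) := by
  rw [cylinder, haar_real_univ_prod, Measure.addHaar_real_closedBall_center]

/-- Enlarging the radius by `R` makes the translated cylinder contain every motion with translation
part of norm at most `R`; only the tail of `f` is lost. -/
theorem abs_setIntegral_cylinder_sub_le (hf : Integrable f (haar n)) {R ε : ℝ}
    (htail : ∫ y in {y : MotionGroup n | R < ‖y.2‖}, |f y| ∂(haar n) ≤ ε)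
    {p : EucSpace n} {s : ℝ} {g : MotionGroup n} (hg : g ∈ cylinder p s) :
    |∫ y in (g * ·) ⁻¹' cylinder p (s + R), f y ∂(haar n) - ∫ y, f y ∂(haar n)| ≤ ε := by
  have hm : MeasurableSet ((g * ·) ⁻¹' cylinder p (s + R)) :=
    measurable_const_mul g (isCompact_cylinder _ _).measurableSet
  have hsub : ((g * ·) ⁻¹' cylinder p (s + R))ᶜ ⊆ {y : MotionGroup n | R < ‖y.2‖} := by
    intro y hy
    by_contra hR
    have hgy : g * y ∈ cylinder p (s + R) :=
      mem_cylinder.2 (snd_mul_mem_closedBall (mem_cylinder.1 hg) (not_lt.1 hR))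
    exact hy hgy
  generalize (g * ·) ⁻¹' cylinder p (s + R) = C at hm hsub ⊢
  rw [← integral_add_compl hm hf, abs_sub_comm, add_sub_cancel_left]
  refine (abs_integral_le_integral_abs).trans (le_trans ?_ htail)
  have h0 : 0 ≤ᵐ[(haar n).restrict {y : MotionGroup n | R < ‖y.2‖}] fun y => |f y| :=
    Eventually.of_forall fun _ => abs_nonneg _
  exact setIntegral_mono_set hf.abs.integrableOn h0 hsub.eventuallyLE

theorem exists_tail_le (hf : Integrable f (haar n)) {ε : ℝ} (hε : 0 < ε) :
    ∃ R : ℝ, 0 ≤ R ∧ ∫ y in {y : MotionGroup n | R < ‖y.2‖}, |f y| ∂(haar n) ≤ ε := by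
  have h := tendsto_setIntegral_of_antitone (μ := haar n) (f := fun y => |f y|)
    (s := fun m : ℕ => {y : MotionGroup n | (m : ℝ) < ‖y.2‖})
    (fun m => measurableSet_lt measurable_const measurable_snd.norm)
    (fun a b hab y (hy : (b : ℝ) < ‖y.2‖) => lt_of_le_of_lt (Nat.cast_le.2 hab) hy) ⟨0, hf.abs.integrableOn⟩
  have he : (⋂ m : ℕ, {y : MotionGroup n | (m : ℝ) < ‖y.2‖}) = ∅ := by
    refine Set.eq_empty_of_forall_notMem fun y hy => ?_
    obtain ⟨m, hm⟩ := exists_nat_ge ‖y.2‖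
    exact absurd (Set.mem_iInter.1 hy m) (not_lt.2 hm)
  rw [he, setIntegral_empty] at h
  obtain ⟨m, hm⟩ := (h.eventually (ge_mem_nhds hε)).exists
  exact ⟨m, m.cast_nonneg, hm⟩

/-- The Haar part lives on radius `s + R`, so every motion in the cylinder of radius `s` sees almost
all of `∫ f`. On the remaining shell the inner integral is merely bounded by `∫ |f|`, which is
harmless because the shell has small relative volume. -/
theorem quadratic_bound (hc : Continuous f) (hp : IsPositiveType fun g => (f g : ℂ)) {R ε : ℝ}
    (hR : 0 ≤ R) (htail : ∫ y in {y : MotionGroup n | R < ‖y.2‖}, |f y| ∂(haar n) ≤ ε)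
    (p : EucSpace n) (s : ℝ) (T : Finset (MotionGroup n)) (hT : ∀ g ∈ T, g ∈ cylinder p s)
    (hneg : ∀ g ∈ T, ∀ h ∈ T, g ≠ h → f (h⁻¹ * g) ≤ 0) {l : ℝ} (hl : 0 ≤ l) :
    0 ≤ T.card * f 1 - 2 * l * (T.card * ((∫ y, f y ∂(haar n)) - ε)) +
      l ^ 2 * (volume.real (Metric.closedBall (0 : EucSpace n) s) * ((∫ y, f y ∂(haar n)) + ε) +
        (volume.real (Metric.closedBall (0 : EucSpace n) (s + R)) -
          volume.real (Metric.closedBall (0 : EucSpace n) s)) * ∫ y, |f y| ∂(haar n)) := by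
  classical
  have hf := integrable_of_isPositiveType hp
  have hs := symm_of_isPositiveType hp
  have hBc := isCompact_cylinder p (s + R)
  have h := pointMasses_nonneg hc hp T hBc l
  have h1 : ∑ g ∈ T, ∑ h ∈ T, f (h⁻¹ * g) ≤ T.card * f 1 := by
    rw [← nsmul_eq_mul]
    refine Finset.sum_le_card_nsmul _ _ _ fun g hg => ?_
    rw [← Finset.add_sum_erase _ _ hg, inv_mul_cancel]
    refine add_le_of_nonpos_right (Finset.sum_nonpos fun h hh => ?_)
    exact hneg g hg h (Finset.mem_of_mem_erase hh) (Finset.ne_of_mem_erase hh).symm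
  have h2 : T.card * ((∫ y, f y ∂(haar n)) - ε) ≤
      ∑ g ∈ T, ∫ y in cylinder p (s + R), f (y⁻¹ * g) ∂(haar n) := by
    rw [← nsmul_eq_mul]
    refine Finset.card_nsmul_le_sum _ _ _ fun g hg => ?_
    rw [setIntegral_inv_mul hs hBc.measurableSet]
    linarith [(abs_le.1 (abs_setIntegral_cylinder_sub_le hf htail (hT g hg))).1]
  have h3 : ∫ q in cylinder p (s + R) ×ˢ cylinder p (s + R), f (q.2⁻¹ * q.1)
      ∂((haar n).prod (haar n)) ≤
      volume.real (Metric.closedBall (0 : EucSpace n) s) * ((∫ y, f y ∂(haar n)) + ε) +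
        (volume.real (Metric.closedBall (0 : EucSpace n) (s + R)) -
          volume.real (Metric.closedBall (0 : EucSpace n) s)) * ∫ y, |f y| ∂(haar n) := by
    have hsub : cylinder p s ⊆ cylinder p (s + R) :=
      Set.prod_mono_right (Metric.closedBall_subset_closedBall (by linarith))
    have hφ : Continuous fun g => ∫ y in cylinder p (s + R), f (y⁻¹ * g) ∂(haar n) :=
      continuous_parametric_integral_of_continuous (f := fun g y => f (y⁻¹ * g))
        (continuous_kernel hc) hBc
    have hm := (isCompact_cylinder p s).measurableSet
    have hfin1 := (isCompact_cylinder p s).measure_ne_top (μ := haar n)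
    have hfin2 := hBc.measure_ne_top (μ := haar n)
    rw [setIntegral_prod _ ((continuous_kernel hc).continuousOn.integrableOn_compact
      (hBc.prod hBc))]
    have hBi : IntegrableOn (fun g => ∫ y in cylinder p (s + R), f (y⁻¹ * g) ∂(haar n))
      (cylinder p (s + R)) (haar n) := hφ.continuousOn.integrableOn_compact hBc
    have hsplit := setIntegral_union Set.disjoint_sdiff_right
      (hBc.measurableSet.diff hm) (hBi.mono_set hsub) (hBi.mono_set Set.sdiff_subset)
    rw [Set.union_sdiff_cancel hsub] at hsplit
    refine hsplit.trans_le ?_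
    refine add_le_add ?_ ?_
    · rw [← haar_real_cylinder p s, ← smul_eq_mul, ← setIntegral_const]
      refine setIntegral_mono_on (hBi.mono_set hsub) (integrableOn_const hfin1) hm fun g hg => ?_
      rw [setIntegral_inv_mul hs hBc.measurableSet]
      linarith [(abs_le.1 (abs_setIntegral_cylinder_sub_le hf htail hg)).2]
    · rw [← haar_real_cylinder p s, ← haar_real_cylinder p (s + R),
        ← measureReal_sdiff hsub hm hfin2, ← smul_eq_mul, ← setIntegral_const]
      refine setIntegral_mono_on (hBi.mono_set Set.sdiff_subset)
        (integrableOn_const (measure_ne_top_of_subset Set.sdiff_subset hfin2))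
        (hBc.measurableSet.diff hm) fun g hg => ?_
      rw [setIntegral_inv_mul hs hBc.measurableSet]
      exact setIntegral_le_integral_abs hf _
  have h4 := mul_le_mul_of_nonneg_left h2 (mul_nonneg zero_le_two hl)
  have h5 := mul_le_mul_of_nonneg_left h3 (sq_nonneg l)
  linarith

end MotionGroup

/-! ### Ball volumes, local finiteness of packings, covered fractions. -/

section Geometry

variable {n : ℕ}

theorem tendsto_volume_closedBall_add_div (D : ℝ) :
    Tendsto (fun r : ℝ => volume.real (Metric.closedBall (0 : EucSpace n) (r + D)) /
      volume.real (Metric.closedBall (0 : EucSpace n) r)) atTop (𝓝 1) := by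
  have h1 : Tendsto (fun r : ℝ => (1 + D / r) ^ n) atTop (𝓝 1) := by
    have := ((tendsto_const_nhds (x := D)).div_atTop tendsto_id).const_add (1 : ℝ) |>.pow n
    simpa using this
  refine h1.congr' ?_
  filter_upwards [eventually_gt_atTop 0, eventually_ge_atTop (-D)] with r hr hD
  have hb : volume.real (Metric.closedBall (0 : EucSpace n) 1) ≠ 0 :=
    (ENNReal.toReal_pos (Metric.measure_closedBall_pos _ _ one_pos).ne'
      (isCompact_closedBall _ _).measure_ne_top).ne'
  rw [Measure.addHaar_real_closedBall' _ _ hr.le,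
    Measure.addHaar_real_closedBall' _ _ (by linarith : 0 ≤ r + D), mul_div_mul_right _ _ hb,
    ← div_pow, finrank_euclideanSpace_fin, add_div, div_self hr.ne']

theorem volume_real_closedBall_pos {r : ℝ} (hr : 0 < r) :
    0 < volume.real (Metric.closedBall (0 : EucSpace n) r) :=
  ENNReal.toReal_pos (Metric.measure_closedBall_pos _ _ hr).ne'
    (isCompact_closedBall _ _).measure_ne_top

theorem volume_real_ball_eq_closedBall (p : EucSpace n) {r : ℝ} (hr : 0 < r) :
    volume.real (Metric.ball p r) = volume.real (Metric.closedBall (0 : EucSpace n) r) := by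
  rw [Measure.addHaar_real_closedBall _ _ hr.le, measureReal_def,
    Measure.addHaar_ball_of_pos _ _ hr, ENNReal.toReal_mul, ENNReal.toReal_ofReal (by positivity)]
  rfl

theorem MotionGroup.copy_subset_closedBall {K : Set (EucSpace n)} {D : ℝ}
    (hD : ∀ v ∈ K, ‖v‖ ≤ D) {g : MotionGroup n} {p : EucSpace n} {s : ℝ}
    (hg : g ∈ cylinder p s) : g.copy K ⊆ Metric.closedBall p (s + D) := by
  rintro _ ⟨v, hv, rfl⟩
  exact snd_mul_mem_closedBall (h := (1, v)) (mem_cylinder.1 hg) (hD v hv)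

/-- Volume count: the copies have disjoint interiors of one common positive volume, all inside a
ball of radius `s + D`. -/
theorem IsCongruentPacking.finite_inter_cylinder {K : Set (EucSpace n)} {S : Set (MotionGroup n)}
    (hS : IsCongruentPacking K S) (hK : (interior K).Nonempty) {D : ℝ}
    (hD : ∀ v ∈ K, ‖v‖ ≤ D) (p : EucSpace n) (s : ℝ) :
    (S ∩ MotionGroup.cylinder p s).Finite := by
  have hpos : 0 < volume (interior K) := isOpen_interior.measure_pos _ hK
  have h := Measure.finite_const_le_meas_of_disjoint_iUnion
    (volume : Measure (EucSpace n)) hpos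
    (As := fun g : (S ∩ MotionGroup.cylinder p s : Set (MotionGroup n)) => interior (g.1.copy K))
    (fun g => isOpen_interior.measurableSet)
    (fun g h hgh => Set.disjoint_iff_inter_eq_empty.2
      (hS g.1 g.2.1 h.1 h.2.1 fun he => hgh (Subtype.ext he)))
    (measure_ne_top_of_subset (Set.iUnion_subset fun g => interior_subset.trans
      (MotionGroup.copy_subset_closedBall hD g.2.2))
      (isCompact_closedBall p (s + D)).measure_ne_top)
  have hall : {g : (S ∩ MotionGroup.cylinder p s : Set (MotionGroup n)) |
      volume (interior K) ≤ volume (interior (g.1.copy K))} = Set.univ := by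
    ext g
    simp [MotionGroup.interior_copy, MotionGroup.volume_copy]
  rw [hall, Set.finite_univ_iff] at h
  exact Set.toFinite _

/-- A point of a copy lies within `D` of its translation part, so copies meeting the ball of radius
`r` are found in the cylinder of radius `r + D`. -/
theorem ball_inter_packingUnion_subset {K : Set (EucSpace n)} (S : Set (MotionGroup n)) {D : ℝ}
    (hD : ∀ v ∈ K, ‖v‖ ≤ D) (p : EucSpace n) (r : ℝ) :
    Metric.ball p r ∩ packingUnion K S ⊆ ⋃ g ∈ S ∩ MotionGroup.cylinder p (r + D), g.copy K := by
  rintro w ⟨hw, hwP⟩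
  obtain ⟨g, hg, hwg⟩ := Set.mem_iUnion₂.1 hwP
  refine Set.mem_iUnion₂.2 ⟨g, ⟨hg, MotionGroup.mem_cylinder.2 ?_⟩, hwg⟩
  obtain ⟨v, hv, rfl⟩ := hwg
  rw [Metric.mem_ball, dist_eq_norm] at hw
  rw [Metric.mem_closedBall, dist_eq_norm]
  dsimp only at hw
  have : g.2 - p = (g.2 + g.1.rotate v - p) - g.1.rotate v := by abel
  rw [this]
  refine (norm_sub_le _ _).trans (add_le_add hw.le ?_)
  rw [RotGroup.norm_rotate]
  exact hD v hv

theorem coveredFraction_le {K : Set (EucSpace n)} (hK : IsCompact K) (S : Set (MotionGroup n))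
    {D : ℝ} (hD : ∀ v ∈ K, ‖v‖ ≤ D) (p : EucSpace n) {r : ℝ} (hr : 0 < r)
    (T : Finset (MotionGroup n)) (hT : (T : Set _) = S ∩ MotionGroup.cylinder p (r + D)) :
    coveredFraction (packingUnion K S) p r ≤
      T.card * volume.real K / volume.real (Metric.closedBall (0 : EucSpace n) r) := by
  rw [coveredFraction, volume_real_ball_eq_closedBall p hr]
  refine div_le_div_of_nonneg_right ?_ measureReal_nonneg
  have hsub := ball_inter_packingUnion_subset S hD p r
  rw [← hT] at hsub
  simp only [Finset.mem_coe] at hsub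
  have hcopy : ∀ g : MotionGroup n, volume.real (g.copy K) = volume.real K := fun g => by
    rw [measureReal_def, MotionGroup.volume_copy, measureReal_def]
  have hfin : ∀ g : MotionGroup n, volume (g.copy K) ≠ ⊤ := fun g => by
    rw [MotionGroup.volume_copy]
    exact hK.measure_ne_top
  refine (measureReal_mono hsub ?_).trans ((measureReal_biUnion_finset_le _ _).trans_eq ?_)
  · exact ((measure_biUnion_lt_top T.finite_toSet fun g _ => (hfin g).lt_top)).ne
  · simp [hcopy]

theorem upperDensity_le_of_eventually {P : Set (EucSpace n)} {c : ℝ}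
    (h : ∀ᶠ r : ℝ in atTop, ∀ p, coveredFraction P p r ≤ c) : upperDensity P ≤ c := by
  refine limsup_le_of_le ?_ (h.mono fun r hr => ciSup_le hr)
  -- The real `limsup` bound needs a lower bound on the suprema; they are nonnegative.
  refine isCoboundedUnder_le_of_le atTop (x := 0) fun r => Real.iSup_nonneg fun p => ?_
  exact div_nonneg measureReal_nonneg measureReal_nonneg

theorem HasDensity.le_of_eventually {P : Set (EucSpace n)} {c Δ : ℝ}
    (h : ∀ᶠ r : ℝ in atTop, ∀ p, coveredFraction P p r ≤ c) (hΔ : HasDensity P Δ) : Δ ≤ c :=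
  le_of_tendsto (hΔ 0) (h.mono fun _ hr => hr 0)

end Geometry

/-! ### The asymptotic cardinality bound and the theorem. -/

namespace MotionGroup

variable {n : ℕ} {f : MotionGroup n → ℝ}

/-- For large `s`, uniformly in the centre `p`, a finite set `T` of motions with translation parts
in `B(p, s)` and `f ≤ 0` on its differences has at most about `vol B(p, s) f(1) / ∫ f` elements. -/
theorem eventually_card_mul_le (hc : Continuous f) (hp : IsPositiveType fun g => (f g : ℂ))
    {a : ℝ} (ha : a < ∫ g, f g ∂(haar n)) :
    ∀ᶠ s : ℝ in atTop, ∀ (p : EucSpace n) (T : Finset (MotionGroup n)),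
      (∀ g ∈ T, g ∈ cylinder p s) → (∀ g ∈ T, ∀ h ∈ T, g ≠ h → f (h⁻¹ * g) ≤ 0) →
      T.card * a ≤ volume.real (Metric.closedBall (0 : EucSpace n) s) * f 1 := by
  set F := ∫ g, f g ∂(haar n) with hF
  set L := ∫ g, |f g| ∂(haar n) with hL
  -- Chosen so that `2 * (F - ε) - (F + 2 * ε) = F - 4 * ε = a`.
  set ε := (F - a) / 4 with hε
  have hε0 : 0 < ε := by rw [hε]; linarith
  obtain ⟨R, hR, htail⟩ := exists_tail_le (integrable_of_isPositiveType hp) hε0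
  have hlim : Tendsto (fun s : ℝ => (volume.real (Metric.closedBall (0 : EucSpace n) (s + R)) /
      volume.real (Metric.closedBall (0 : EucSpace n) s) - 1) * L) atTop (𝓝 0) := by
    simpa using ((tendsto_volume_closedBall_add_div (n := n) R).sub_const 1).mul_const L
  filter_upwards [hlim.eventually (ge_mem_nhds hε0), eventually_gt_atTop 0]
    with s hs hs0 p T hT hneg
  rcases T.eq_empty_or_nonempty with rfl | hne
  · simpa using mul_nonneg measureReal_nonneg (nonneg_one_of_isPositiveType hc hp)
  have hN : (0 : ℝ) < T.card := Nat.cast_pos.2 hne.card_pos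
  have hV := volume_real_closedBall_pos (n := n) hs0
  -- Taking `l = |T| / V` minimizes the error-free quadratic `|T| f(1) - 2 l |T| F + l² V F`.
  have h := quadratic_bound hc hp hR htail p s T hT hneg
    (div_nonneg hN.le hV.le)
  rw [← hF, ← hL] at h
  set V := volume.real (Metric.closedBall (0 : EucSpace n) s)
  set V' := volume.real (Metric.closedBall (0 : EucSpace n) (s + R))
  have hY : V * (F + ε) + (V' - V) * L ≤ V * (F + 2 * ε) := by
    have h2 : (V' - V) * L = V * ((V' / V - 1) * L) := by field_simp
    rw [h2]
    nlinarith [mul_le_mul_of_nonneg_left hs hV.le]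
  have h3 : 0 ≤ T.card * f 1 - 2 * (T.card / V) * (T.card * (F - ε)) +
      (T.card / V) ^ 2 * (V * (F + 2 * ε)) :=
    h.trans (by gcongr)
  have h4 : T.card * f 1 - 2 * (T.card / V) * (T.card * (F - ε)) +
      (T.card / V) ^ 2 * (V * (F + 2 * ε)) = T.card / V * (V * f 1 - T.card * a) := by
    have : a = F - 4 * ε := by rw [hε]; ring
    rw [this]
    clear_value V F ε
    generalize (T.card : ℝ) = N, f 1 = y
    field_simp
    ring
  rw [h4] at h3
  have := nonneg_of_mul_nonneg_right h3 (div_pos hN hV)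
  linarith

end MotionGroup

/-- Upper bound for the density of packings of congruent copies of a convex body. -/
theorem theorem5 (n : ℕ) (K : ConvexBody (EucSpace n))
    (hK : (interior (K : Set (EucSpace n))).Nonempty)
    (f : MotionGroup n → ℝ) (hf : RapidlyDecreasing f)
    (h_nonpos : ∀ g : MotionGroup n,
      interior (g.copy (K : Set (EucSpace n))) ∩ interior (K : Set (EucSpace n)) = ∅ → f g ≤ 0)
    (h_int : volume.real (K : Set (EucSpace n)) ≤ ∫ g, f g ∂(MotionGroup.haar n))
    (h_pos : IsPositiveType (fun g => (f g : ℂ)))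
    (S : Set (MotionGroup n)) (hS : IsCongruentPacking (K : Set (EucSpace n)) S) :
    upperDensity (packingUnion (K : Set (EucSpace n)) S) ≤ f (1, 0) ∧
      ∀ Δ : ℝ, HasDensity (packingUnion (K : Set (EucSpace n)) S) Δ → Δ ≤ f (1, 0) := by
  have hc : Continuous f := hf.1
  have hf1 : 0 ≤ f 1 := MotionGroup.nonneg_one_of_isPositiveType hc h_pos
  have hKpos : 0 < volume.real (K : Set (EucSpace n)) :=
    ENNReal.toReal_pos (Measure.measure_pos_of_nonempty_interior _ hK).ne'
      K.isCompact.measure_ne_top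
  obtain ⟨D, hD⟩ := K.isBounded.exists_norm_le
  -- One factor `θ` gives the strict inequality `vol K / θ < ∫ f`; the other absorbs the volume
  -- ratio of the balls of radii `r + D` and `r`. Both disappear as `θ` decreases to `1`.
  have hbound : ∀ θ : ℝ, 1 < θ → ∀ᶠ r : ℝ in atTop, ∀ p,
      coveredFraction (packingUnion (K : Set (EucSpace n)) S) p r ≤ θ * θ * f 1 := by
    intro θ hθ
    have hθ0 : 0 < θ := one_pos.trans hθ
    have ha : volume.real (K : Set (EucSpace n)) / θ < ∫ g, f g ∂(MotionGroup.haar n) :=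
      (div_lt_self hKpos hθ).trans_le h_int
    have hcard := (tendsto_atTop_add_const_right atTop D tendsto_id).eventually
      (MotionGroup.eventually_card_mul_le hc h_pos ha)
    have hratio := (tendsto_volume_closedBall_add_div (n := n) D).eventually (ge_mem_nhds hθ)
    filter_upwards [hcard, hratio, eventually_gt_atTop 0] with r hr hrat hr0 p
    have hfin := hS.finite_inter_cylinder hK hD p (r + D)
    have hV := volume_real_closedBall_pos (n := n) hr0
    refine (coveredFraction_le K.isCompact S hD p hr0 hfin.toFinset
      hfin.coe_toFinset).trans ?_
    have h1 := hr p hfin.toFinset (fun g hg => (hfin.mem_toFinset.1 hg).2)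
      fun g hg h hh hgh => h_nonpos _ (MotionGroup.interior_inv_mul_copy_inter
        (hS g (hfin.mem_toFinset.1 hg).1 h (hfin.mem_toFinset.1 hh).1 hgh))
    rw [div_le_iff₀ hV] at hrat
    rw [div_le_iff₀ hV]
    rw [mul_div_assoc', div_le_iff₀ hθ0] at h1
    refine h1.trans ?_
    have h2 := mul_le_mul_of_nonneg_right hrat (mul_nonneg hf1 hθ0.le)
    simp only [id_eq]
    linarith
  have hlim : Tendsto (fun θ : ℝ => θ * θ * f 1) (𝓝[>] 1) (𝓝 (f 1)) := by
    have : Continuous fun θ : ℝ => θ * θ * f 1 := by fun_prop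
    simpa using (this.tendsto 1).mono_left nhdsWithin_le_nhds
  exact ⟨ge_of_tendsto hlim (eventually_mem_nhdsWithin.mono fun θ hθ =>
      upperDensity_le_of_eventually (hbound θ hθ)),
    fun Δ hΔ => ge_of_tendsto hlim (eventually_mem_nhdsWithin.mono fun θ hθ =>
      HasDensity.le_of_eventually (hbound θ hθ) hΔ)⟩
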